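/- For natural numbers $k,n$ let $B(k,n,1/2)$ be the distribution of the random bipartite graph $H=(U,V,E)$ with $|U|=k$, $|V|=n$, in which each of the $kn$ possible edges is present independently with probability $1/2$. For a bipartite graph $H=(U,V,E)$ with $|U|=k$, $|V|=n$ and a real number $\ell$, the basic SDP relaxation for $\ell$ by $k-\ell$ bicliques in $H$ asks for a symmetric real matrix $X$, with rows and columns indexed by the disjoint union $U\sqcup V$, such that $$ \begin{aligned} & 0\le X(i,j)\le 1 \ \text{ for all } i,j\in U\sqcup V, \qquad \operatorname{tr}(X)=k,\\ & \sum_{u\in U}X(u,u)=\ell,\qquad \sum_{v\in V}X(v,v)=k-\ell,\qquad \sum_{u\in U,\,v\in V}X(u,v)=\ell(k-\ell),\\ & X(u,v)=0 \ \text{ for all } u\in U,\ v\in V \text{ with } \{u,v\}\notin E,\qquad X\succeq 0 . \end{aligned} $$ It is feasible if such an $X$ exists. **Lemma.** There is an absolute constant $c>0$ such that for all natural numbers $n,k$ with $100\sqrt n\le k\le n/2$ the following holds. With probability at least $0.99$ over $H\sim B(k,n,1/2)$, for every real $\ell$ with $0\le \ell\le cn/k$ (in particular for every such integer $\ell$),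 the basic SDP relaxation for $\ell$ by $k-\ell$ bicliques in $H$ is feasible. -/

import Mathlib

/-- A bipartite graph `H = (U, V, E)` with left vertex set `U` and right vertex set `V`, given by
its edge set `E`; the pair `(u, v) ∈ E` stands for the edge `{u, v}`. -/
abbrev BipartiteGraph (U V : Type*) : Type _ := Set (U × V)

/-- The distribution `B(k, n, p)`: the bipartite graph with `k` left and `n` right vertices in which
every one of the `k * n` possible edges is present with probability `p`, independently. -/
noncomputable def bipartiteErdosRenyi (k n : ℕ) (p : unitInterval) :
    MeasureTheory.Measure (BipartiteGraph (Fin k) (Fin n)) :=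
  ProbabilityTheory.setBernoulli Set.univ p

/-- `X` is a feasible point of the basic SDP relaxation for `ℓ` by `k - ℓ` bicliques in the
bipartite graph `H = (U, V, E)`. The rows and columns of the real matrix `X` are indexed by all the
vertices, left (`Sum.inl`) and right (`Sum.inr`). `Matrix.PosSemidef` includes symmetry. -/
structure IsBasicSDPSolution {U V : Type*} [Fintype U] [Fintype V] (H : BipartiteGraph U V)
    (k ℓ : ℝ) (X : Matrix (U ⊕ V) (U ⊕ V) ℝ) : Prop where
  entry_mem : ∀ i j, 0 ≤ X i j ∧ X i j ≤ 1
  trace_eq : X.trace = k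
  left_trace_eq : ∑ u : U, X (Sum.inl u) (Sum.inl u) = ℓ
  right_trace_eq : ∑ v : V, X (Sum.inr v) (Sum.inr v) = k - ℓ
  cross_sum_eq : ∑ u : U, ∑ v : V, X (Sum.inl u) (Sum.inr v) = ℓ * (k - ℓ)
  nonedge_eq_zero : ∀ u v, (u, v) ∉ H → X (Sum.inl u) (Sum.inr v) = 0
  posSemidef : X.PosSemidef

/-- The basic SDP relaxation for `ℓ` by `k - ℓ` bicliques in `H` is feasible. -/
def BasicSDPFeasible {U V : Type*} [Fintype U] [Fintype V] (H : BipartiteGraph U V)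
    (k ℓ : ℝ) : Prop :=
  ∃ X : Matrix (U ⊕ V) (U ⊕ V) ℝ, IsBasicSDPSolution H k ℓ X

open MeasureTheory ProbabilityTheory

/-- A Chernoff bound for the lower tail of the size of a uniformly random subset. -/
lemma setBernoulli_half_real_ncard_lt_quarter_le {ι : Type*} [Finite ι] (p : unitInterval)
    (hp : (p : ℝ) = 1 / 2) :
    (setBernoulli (Set.univ : Set ι) p).real {s | 4 * s.ncard < Nat.card ι} ≤
      (25 / 32 : ℝ) ^ (Nat.card ι / 2) := by
  have : Countable ι := Finite.to_countable
  set N := Nat.card ι with hN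
  set J := (Finset.range (N + 1)).filter (fun j => 4 * j < N) with hJ
  have hset : {s : Set ι | 4 * s.ncard < N} = Set.ncard ⁻¹' (J : Set ℕ) := by
    ext s
    simp only [hJ, Set.mem_ofPred_eq, Set.mem_preimage, Finset.mem_coe, Finset.mem_filter,
      Finset.mem_range]
    omega
  have hmeas : Measurable (Set.ncard : Set ι → ℕ) := by fun_prop
  rw [hset, ← map_measureReal_apply hmeas J.measurableSet, ← sum_measureReal_singleton]
  have hterm : ∀ j ∈ J, ((setBernoulli (Set.univ : Set ι) p).map Set.ncard).real {j} ≤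
      (1 / 2 : ℝ) ^ N * 2 ^ (N / 2) * ((1 / 4 : ℝ) ^ j * 1 ^ (N - j) * (N.choose j)) := by
    intro j hj
    simp only [hJ, Finset.mem_filter, Finset.mem_range] at hj
    rw [map_ncard_setBernoulli_real_singleton Set.finite_univ, Set.ncard_univ, ← hN, hp]
    have h1 : (1 / 2 : ℝ) ^ j * (1 - 1 / 2) ^ (N - j) = (1 / 2) ^ N := by
      rw [show (1 - 1 / 2 : ℝ) = 1 / 2 by norm_num, ← pow_add]
      congr 1
      omega
    have h2 : (1 : ℝ) ≤ 2 ^ (N / 2) * (1 / 4) ^ j := by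
      have h3 : (2 : ℝ) ^ (N / 2) = 2 ^ (N / 2 - 2 * j) * 4 ^ j := by
        rw [show (4 : ℝ) = 2 ^ 2 by norm_num, ← pow_mul, ← pow_add]
        congr 1
        omega
      rw [h3, mul_assoc, ← mul_pow]
      norm_num
      exact one_le_pow₀ (by norm_num)
    rw [mul_assoc, h1, one_pow, mul_one]
    calc (N.choose j : ℝ) * (1 / 2) ^ N = (1 / 2) ^ N * N.choose j * 1 := by ring
      _ ≤ (1 / 2) ^ N * N.choose j * (2 ^ (N / 2) * (1 / 4) ^ j) := by gcongr
      _ = _ := by ring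
  calc ∑ j ∈ J, ((setBernoulli (Set.univ : Set ι) p).map Set.ncard).real {j}
      ≤ ∑ j ∈ J, (1 / 2 : ℝ) ^ N * 2 ^ (N / 2) *
          ((1 / 4 : ℝ) ^ j * 1 ^ (N - j) * (N.choose j)) := Finset.sum_le_sum hterm
    _ ≤ ∑ j ∈ Finset.range (N + 1), (1 / 2 : ℝ) ^ N * 2 ^ (N / 2) *
          ((1 / 4 : ℝ) ^ j * 1 ^ (N - j) * (N.choose j)) :=
        Finset.sum_le_sum_of_subset_of_nonneg (Finset.filter_subset _ _)
          fun _ _ _ => by positivity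
    _ = (1 / 2 : ℝ) ^ N * 2 ^ (N / 2) * (1 / 4 + 1) ^ N := by rw [← Finset.mul_sum, ← add_pow]
    _ = (5 / 8 : ℝ) ^ N * 2 ^ (N / 2) := by
        rw [mul_right_comm, ← mul_pow]
        norm_num
    _ ≤ (5 / 8 : ℝ) ^ (2 * (N / 2)) * 2 ^ (N / 2) := by
        gcongr 1
        exact pow_le_pow_of_le_one (by norm_num) (by norm_num) (by omega)
    _ = (25 / 32 : ℝ) ^ (N / 2) := by
        rw [pow_mul, ← mul_pow]
        norm_num

section StarSolution

variable {U V : Type*} [Fintype U]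

/-- The vector `a · e_u + b · 1_{N(u)}`, supported on the star of `u` in `H`. -/
noncomputable def starVector [DecidableEq U] (H : BipartiteGraph U V) (a b : ℝ) (u : U) :
    U ⊕ V → ℝ :=
  Sum.elim (Pi.single u a) (fun v => b * H.indicator 1 (u, v))

/-- The Gram matrix of the star vectors of `H`, plus `d` times the identity on the right side. -/
noncomputable def starMatrix [DecidableEq U] [DecidableEq V] (H : BipartiteGraph U V)
    (a b d : ℝ) : Matrix (U ⊕ V) (U ⊕ V) ℝ :=
  ∑ u, Matrix.vecMulVec (starVector H a b u) (starVector H a b u) +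
    Matrix.diagonal (Sum.elim 0 fun _ => d)

variable [DecidableEq U] [DecidableEq V] (H : BipartiteGraph U V) (a b d : ℝ)

lemma starMatrix_posSemidef [Fintype V] (hd : 0 ≤ d) : (starMatrix H a b d).PosSemidef := by
  refine .add (Matrix.posSemidef_sum _ fun u _ => ?_) (.diagonal ?_)
  · simpa using Matrix.posSemidef_vecMulVec_self_star (starVector H a b u)
  · rintro (u | v) <;> simp [hd]

lemma starMatrix_inl_inl (u u' : U) :
    starMatrix H a b d (.inl u) (.inl u') = if u = u' then a ^ 2 else 0 := by
  rw [starMatrix, Matrix.add_apply, Matrix.sum_apply]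
  rcases eq_or_ne u u' with rfl | h
  · simp [Matrix.vecMulVec_apply, starVector, Pi.single_apply, sq]
  · simp [Matrix.vecMulVec_apply, starVector, Pi.single_apply, h]

lemma starMatrix_inl_inr (u : U) (v : V) :
    starMatrix H a b d (.inl u) (.inr v) = a * b * H.indicator 1 (u, v) := by
  rw [starMatrix, Matrix.add_apply, Matrix.sum_apply]
  simp [Matrix.vecMulVec_apply, starVector, Pi.single_apply, mul_assoc]

lemma starMatrix_inr_inl (u : U) (v : V) :
    starMatrix H a b d (.inr v) (.inl u) = a * b * H.indicator 1 (u, v) := by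
  rw [starMatrix, Matrix.add_apply, Matrix.sum_apply]
  simp [Matrix.vecMulVec_apply, starVector, Pi.single_apply]
  ring

lemma starMatrix_inr_inr (v v' : V) :
    starMatrix H a b d (.inr v) (.inr v') =
      b ^ 2 * ∑ u, H.indicator (1 : U × V → ℝ) (u, v) * H.indicator 1 (u, v') +
        if v = v' then d else 0 := by
  rw [starMatrix, Matrix.add_apply, Matrix.sum_apply, Finset.mul_sum]
  congr 1
  · refine Finset.sum_congr rfl fun u _ => ?_
    simp only [Matrix.vecMulVec_apply, starVector, Sum.elim_inr]
    ring
  · simp [Matrix.diagonal_apply]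

omit [DecidableEq U] [DecidableEq V] in
lemma sum_indicator_eq_ncard [Fintype V] :
    ∑ u, ∑ v, H.indicator (1 : U × V → ℝ) (u, v) = H.ncard := by
  classical
  rw [← Fintype.sum_prod_type', Set.ncard_eq_toFinset_card']
  simp [Set.indicator_apply]

end StarSolution

/-- A bipartite graph of constant edge density is feasible for all `ℓ` up to a constant times
`|V| / |U|`. -/
lemma basicSDPFeasible_of_card_edges {k n : ℕ} (hk0 : 0 < k) (hkn : (k : ℝ) ≤ n / 2)
    (hnk : (n : ℝ) ≤ k ^ 2) (H : BipartiteGraph (Fin k) (Fin n)) (hH : k * n ≤ 4 * H.ncard)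
    {ℓ : ℝ} (hℓ0 : 0 ≤ ℓ) (hℓ : ℓ ≤ 1 / 16 * n / k) : BasicSDPFeasible H (k : ℝ) ℓ := by
  set e : ℝ := (H.ncard : ℝ) with he
  have hk : (0 : ℝ) < k := by exact_mod_cast hk0
  have hk1 : (1 : ℝ) ≤ k := by exact_mod_cast hk0
  have hn : (0 : ℝ) < n := by linarith
  have hkne : (k * n : ℝ) ≤ 4 * e := by rw [he]; exact_mod_cast hH
  have hkn0 : 0 < (k * n : ℝ) := by positivity
  have he0 : 0 < e := by linarith
  have hℓk : ℓ * k ≤ n / 16 := by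
    rw [le_div_iff₀ hk] at hℓ
    linarith
  have hℓ_le : ℓ ≤ k / 16 := by nlinarith
  have hm0 : 0 ≤ k - ℓ := by linarith
  set a := √(ℓ / k) with ha
  set b := (k - ℓ) * √(ℓ * k) / e with hb
  have ha2 : a ^ 2 = ℓ / k := Real.sq_sqrt (by positivity)
  have hb2 : b ^ 2 = (k - ℓ) ^ 2 * (ℓ * k) / e ^ 2 := by
    rw [hb, div_pow, mul_pow, Real.sq_sqrt (by positivity)]
  have hab : a * b = ℓ * (k - ℓ) / e := by
    have h : √(ℓ / k) * √(ℓ * k) = ℓ := by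
      rw [← Real.sqrt_mul (by positivity), show ℓ / k * (ℓ * k) = ℓ ^ 2 by field_simp,
        Real.sqrt_sq hℓ0]
    calc a * b = (√(ℓ / k) * √(ℓ * k)) * (k - ℓ) / e := by rw [ha, hb]; ring
      _ = _ := by rw [h]
  have hbe : b ^ 2 * e ≤ k - ℓ := by
    have h : b ^ 2 * e = (k - ℓ) * ((k - ℓ) * (ℓ * k) / e) := by
      rw [hb2]
      field_simp
    rw [h]
    refine mul_le_of_le_one_right hm0 ?_
    rw [div_le_one he0]
    nlinarith [mul_nonneg hℓ0 hk.le]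
  have hbk : b ^ 2 * k ≤ 1 / 2 := by
    have h1 : (k - ℓ) ^ 2 ≤ (k : ℝ) ^ 2 := by gcongr; linarith
    have h2 : (k * n / 4 : ℝ) ^ 2 ≤ e ^ 2 := by gcongr; linarith
    rw [hb2, div_mul_eq_mul_div, div_le_iff₀ (by positivity)]
    calc (k - ℓ) ^ 2 * (ℓ * k) * (k : ℝ) ≤ (k : ℝ) ^ 2 * (n / 16) * (n / 2) := by gcongr
      _ = 1 / 2 * (k * n / 4 : ℝ) ^ 2 := by ring
      _ ≤ _ := by gcongr
  set d := ((k - ℓ) - b ^ 2 * e) / n with hd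
  have hd0 : 0 ≤ d := div_nonneg (by linarith) hn.le
  have hd1 : d ≤ 1 / 2 := by
    rw [hd, div_le_iff₀ hn]
    nlinarith [sq_nonneg b, mul_nonneg (sq_nonneg b) he0.le]
  have hab0 : 0 ≤ a * b := by rw [hab]; positivity
  have hab1 : a * b ≤ 1 := by
    rw [hab, div_le_one he0]
    nlinarith
  have hind0 : ∀ x, 0 ≤ H.indicator (1 : Fin k × Fin n → ℝ) x :=
    fun x => Set.indicator_nonneg (fun _ _ => zero_le_one) x
  have hind1 : ∀ x, H.indicator (1 : Fin k × Fin n → ℝ) x ≤ 1 :=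
    fun x => Set.indicator_le_self' (fun _ _ => zero_le_one) x
  have hleft : ∑ u, starMatrix H a b d (.inl u) (.inl u) = ℓ := by
    simp only [starMatrix_inl_inl, if_true, ha2, Finset.sum_const, Finset.card_univ,
      Fintype.card_fin, nsmul_eq_mul]
    field_simp
  have hright : ∑ v, starMatrix H a b d (.inr v) (.inr v) = k - ℓ := by
    have hidem : ∀ x, H.indicator (1 : Fin k × Fin n → ℝ) x * H.indicator 1 x = H.indicator 1 x := by
      intro x
      by_cases hx : x ∈ H <;> simp [hx]
    simp only [starMatrix_inr_inr, if_true, hidem]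
    rw [Finset.sum_add_distrib, ← Finset.mul_sum, Finset.sum_comm, sum_indicator_eq_ncard, ← he]
    simp only [Finset.sum_const, Finset.card_univ, Fintype.card_fin, nsmul_eq_mul, hd]
    field_simp
    ring
  refine ⟨starMatrix H a b d, ?_, ?_, hleft, hright, ?_, ?_, starMatrix_posSemidef H a b d hd0⟩
  · rintro (u | v) (u' | v')
    · rw [starMatrix_inl_inl]
      have h1 : ℓ / k ≤ 1 := by
        rw [div_le_one hk]
        linarith
      split_ifs
      · exact ⟨sq_nonneg a, ha2 ▸ h1⟩
      · norm_num
    · rw [starMatrix_inl_inr]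
      exact ⟨mul_nonneg hab0 (hind0 _), mul_le_one₀ hab1 (hind0 _) (hind1 _)⟩
    · rw [starMatrix_inr_inl]
      exact ⟨mul_nonneg hab0 (hind0 _), mul_le_one₀ hab1 (hind0 _) (hind1 _)⟩
    · rw [starMatrix_inr_inr]
      have h0 : 0 ≤ ∑ u, H.indicator (1 : Fin k × Fin n → ℝ) (u, v) * H.indicator 1 (u, v') :=
        Finset.sum_nonneg fun u _ => mul_nonneg (hind0 _) (hind0 _)
      have h1 : ∑ u, H.indicator (1 : Fin k × Fin n → ℝ) (u, v) * H.indicator 1 (u, v') ≤ k := by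
        calc _ ≤ ∑ _u : Fin k, (1 : ℝ) :=
              Finset.sum_le_sum fun u _ => mul_le_one₀ (hind1 _) (hind0 _) (hind1 _)
          _ = k := by simp
      have h2 : 0 ≤ (if v = v' then d else 0) ∧ (if v = v' then d else 0) ≤ 1 / 2 := by
        split_ifs
        · exact ⟨hd0, hd1⟩
        · norm_num
      have h3 := mul_le_mul_of_nonneg_left h1 (sq_nonneg b)
      exact ⟨add_nonneg (mul_nonneg (sq_nonneg b) h0) h2.1, by linarith⟩
  · rw [Matrix.trace, Fintype.sum_sum_type]
    simp only [Matrix.diag_apply, hleft, hright]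
    ring
  · simp only [starMatrix_inl_inr, ← Finset.mul_sum]
    rw [sum_indicator_eq_ncard, hab, ← he]
    field_simp
  · intro u v huv
    simp [starMatrix_inl_inr, huv]

lemma basicSDPFeasible_zero_of_isEmpty {U V : Type*} [Fintype U] [Fintype V] [IsEmpty U]
    [IsEmpty V] (H : BipartiteGraph U V) : BasicSDPFeasible H 0 0 :=
  ⟨0, by simp, by simp, by simp, by simp, by simp, by simp, .zero⟩

theorem lemma6p1 :
    ∃ c : ℝ, 0 < c ∧ ∀ n k : ℕ, 100 * Real.sqrt (n : ℝ) ≤ (k : ℝ) → (k : ℝ) ≤ (n : ℝ) / 2 →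
      (0.99 : ℝ) ≤ (bipartiteErdosRenyi k n ⟨1 / 2, by norm_num, by norm_num⟩).real
        {H | ∀ ℓ : ℝ, 0 ≤ ℓ → ℓ ≤ c * (n : ℝ) / (k : ℝ) → BasicSDPFeasible H (k : ℝ) ℓ} := by
  refine ⟨1 / 16, by norm_num, fun n k hnk hkn => ?_⟩
  rw [bipartiteErdosRenyi]
  set p : unitInterval := ⟨1 / 2, by norm_num, by norm_num⟩
  set μ := setBernoulli (Set.univ : Set (Fin k × Fin n)) p
  rcases Nat.eq_zero_or_pos n with rfl | hn
  · obtain rfl : k = 0 := by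
      have : (k : ℝ) ≤ 0 := by simpa using hkn
      exact_mod_cast this.antisymm (Nat.cast_nonneg k)
    have huniv : {H : BipartiteGraph (Fin 0) (Fin 0) | ∀ ℓ : ℝ, 0 ≤ ℓ →
        ℓ ≤ 1 / 16 * ((0 : ℕ) : ℝ) / ((0 : ℕ) : ℝ) → BasicSDPFeasible H ((0 : ℕ) : ℝ) ℓ} =
        Set.univ := by
      refine Set.eq_univ_of_forall fun H ℓ h0 h1 => ?_
      obtain rfl : ℓ = 0 := le_antisymm (by simpa using h1) h0
      simpa using basicSDPFeasible_zero_of_isEmpty H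
    rw [huniv, probReal_univ]
    norm_num
  · have hn1 : (1 : ℝ) ≤ n := by exact_mod_cast hn
    have hsqrt : 1 ≤ √(n : ℝ) := Real.one_le_sqrt.2 hn1
    have hk100 : (100 : ℝ) ≤ k := by linarith
    have hk : 100 ≤ k := by exact_mod_cast hk100
    have hnk2 : (n : ℝ) ≤ k ^ 2 := by
      nlinarith [Real.sq_sqrt (Nat.cast_nonneg (α := ℝ) n)]
    have hcard : Nat.card (Fin k × Fin n) = k * n := by simp
    have hbad := setBernoulli_half_real_ncard_lt_quarter_le (ι := Fin k × Fin n) p rfl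
    have hsmall : (25 / 32 : ℝ) ^ (k * n / 2) ≤ 0.01 := by
      have hN : 20 ≤ k * n / 2 := by
        have : 100 * 1 ≤ k * n := Nat.mul_le_mul hk hn
        omega
      calc (25 / 32 : ℝ) ^ (k * n / 2) ≤ (25 / 32) ^ 20 :=
            pow_le_pow_of_le_one (by norm_num) (by norm_num) hN
        _ ≤ _ := by norm_num
    rw [hcard] at hbad
    have hcover : (Set.univ : Set (BipartiteGraph (Fin k) (Fin n))) ⊆
        {H | ∀ ℓ : ℝ, 0 ≤ ℓ → ℓ ≤ 1 / 16 * (n : ℝ) / (k : ℝ) → BasicSDPFeasible H (k : ℝ) ℓ} ∪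
          {H | 4 * H.ncard < k * n} := by
      intro H _
      by_cases hH : 4 * H.ncard < k * n
      · exact .inr hH
      · exact .inl fun ℓ h0 h1 =>
          basicSDPFeasible_of_card_edges (by omega) hkn hnk2 H (not_lt.1 hH) h0 h1
    have h1 := (measureReal_mono hcover (μ := μ)).trans (measureReal_union_le _ _)
    rw [probReal_univ] at h1
    norm_num at hsmall ⊢
    linarith
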